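/- Lemma 1.1: Let $K$ be an algebraically closed field with $\mathrm{char}(K)\neq 2$. Let $f,g\in K[X_0,X_1,X_2]$ be irreducible homogeneous polynomials, and let $\Gamma=\{f=0\}$ and $\Delta=\{g=0\}$ be the corresponding (absolutely irreducible) curves in the projective plane $\mathbb{P}^2(K)$. Suppose that $\Gamma\neq\Delta$ and that each of $\Gamma$ and $\Delta$ has only finitely many inflection points. Then $\Gamma$ and $\Delta$ have only finitely many common tangents; that is, only finitely many lines of $\mathbb{P}^2(K)$ are tangents both to $\Gamma$ and to $\Delta$ (possibly at different points). Here a point $P\in\Gamma$ is simple if the partial derivatives $\partial f/\partial X_i$, $i=0,1,2$, do not all vanish at $P$; the tangent line to $\Gamma$ at a simple point $P$ is the line $\sum_{i}\frac{\partial f}{\partial X_i}(P)\,X_i=0$; a tangent to $\Gamma$ is the tangent line to $\Gamma$ at some simple point of $\Gamma$; and an inflection point of $\Gamma$ is a simple point at which the tangent line meets $\Gamma$ with intersection multiplicity at least $3$ (the multiplicity being $\infty$ if the line is contained in $\Gamma$). The same notions are used for $\Delta$ and $g$. -/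

import Mathlib

namespace PlaneCurve

/-- The projective plane over `K`, i.e. the set of its `K`-points. -/
abbrev Plane (K : Type*) [Field K] : Type _ := Projectivization K (Fin 3 → K)

/-- The plane curve `f = 0`, as a set of points of the projective plane. For homogeneous `f` the
condition does not depend on the chosen representative of the point; the same holds for all the
definitions below. -/
def zeroLocus {K : Type*} [Field K] (f : MvPolynomial (Fin 3) K) : Set (Plane K) :=
  {P | MvPolynomial.eval P.rep f = 0}

/-- `P` is a simple point of the curve `f = 0`. -/
def IsSimplePoint {K : Type*} [Field K] (f : MvPolynomial (Fin 3) K) (P : Plane K) : Prop :=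
  P ∈ zeroLocus f ∧ ∃ i, MvPolynomial.eval P.rep (MvPolynomial.pderiv i f) ≠ 0

/-- The tangent line to the curve `f = 0` at `P` (a line of the plane when `P` is a simple
point). -/
def tangentLine {K : Type*} [Field K] (f : MvPolynomial (Fin 3) K) (P : Plane K) :
    Set (Plane K) :=
  {Q | ∑ i, MvPolynomial.eval P.rep (MvPolynomial.pderiv i f) * Q.rep i = 0}

/-- `L` is a tangent of the curve `f = 0`: it is the tangent line at some simple point. -/
def IsTangent {K : Type*} [Field K] (f : MvPolynomial (Fin 3) K) (L : Set (Plane K)) : Prop :=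
  ∃ P, IsSimplePoint f P ∧ L = tangentLine f P

/-- For `Q ≠ P`, the intersection multiplicity at `P` of the curve `f = 0` with the line through
`P` and `Q`: the order of vanishing at `t = 0` of `f (P + t Q)`, which is `⊤` when `f` vanishes
identically on the line. -/
noncomputable def lineMultiplicity {K : Type*} [Field K] (f : MvPolynomial (Fin 3) K)
    (P Q : Plane K) : ℕ∞ :=
  emultiplicity (Polynomial.X : Polynomial K)
    (MvPolynomial.aeval
      (fun i => Polynomial.C (P.rep i) + Polynomial.X * Polynomial.C (Q.rep i)) f)

/-- `P` is an inflection point of the curve `f = 0`: a simple point at which the tangent line meets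
the curve with multiplicity at least `3`. (The tangent line is the line through `P` and any of its
other points `Q`, and the multiplicity does not depend on `Q`.) -/
def IsInflectionPoint {K : Type*} [Field K] (f : MvPolynomial (Fin 3) K) (P : Plane K) : Prop :=
  IsSimplePoint f P ∧ ∀ Q ∈ tangentLine f P, Q ≠ P → 3 ≤ lineMultiplicity f P Q

end PlaneCurve

/-!
Suppose that there are infinitely many common tangents `L_s`, `s ∈ S`, touching `f = 0` at `P_s` and
`g = 0` at `Q_s`. Each of `P_s` and `Q_s` determines `L_s`, so `s ↦ P_s` and `s ↦ Q_s` are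
injective.
For a non-principal ultrafilter on `S`, these families define points `p` and `q` of the two curves
over the ultrapower of `K`; they have the same tangent `l`, and `p` is not a `K`-point.

Scale `p`, `q` and `l` so that each has a coordinate equal to `1`, and let `E` be the field generated
over `K` by the coordinates of `p` and `q`. It is a finitely generated proper extension of the
algebraically closed field `K`, hence carries a nonzero `K`-derivation `D`
(`exists_derivation_ne_zero`). From `l · p = 0` and `l · D p = 0` one gets `D l · p = 0`, and likewise
`D l · q = 0` (`sum_derivation_mul_eq_zero`).

* If `D l ≠ 0`, then `l` and `D l` are independent, so that `p = q` as points of the plane; this is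
  biduality. Then `P_s = Q_s` for infinitely many `s`, the two curves have infinitely many common
  points, and `f` and `g` are associated (`associated_of_infinite_inter`).
* If `D l = 0`, then one of `D p`, `D q`, say `v = D p`, is nonzero. Differentiating the
  proportionality of `l` and the gradient of `f` at `p` shows that the Hessian form of `f` at `p`
  vanishes at the tangent vector `v` (`isFlex_of_derivation`). The same then holds for infinitely many
  `P_s`, and as `2 ≠ 0` in `K` these are inflection points (`IsFlex.isInflectionPoint`).

Taking `D` on `E`, and not on the field generated by `p` alone, avoids any separability
question: a derivation of the smaller field need not extend to `E`, whereas a derivation of `E` that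
kills `p` cannot kill `q`, and the roles of the two curves are symmetric.
-/

namespace PlaneCurve

open MvPolynomial Filter

/-! ### Curves with infinitely many common points -/

/-- Non-associated irreducible polynomials are coprime over the fraction field of `R`, by Gauss's
lemma; clearing denominators in a Bézout relation eliminates the variable. -/
theorem exists_mul_add_mul_eq_C_of_irreducible {R : Type*} [CommRing R] [IsDomain R]
    [UniqueFactorizationMonoid R] {F G : Polynomial R} (hF : Irreducible F)
    (hG : Irreducible G) (h : ¬ Associated F G) :
    ∃ (d : R) (A B : Polynomial R), d ≠ 0 ∧ A * F + B * G = Polynomial.C d := by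
  classical
  by_cases hF0 : F.natDegree = 0
  · obtain ⟨d, rfl⟩ := Polynomial.natDegree_eq_zero.1 hF0
    exact ⟨d, 1, 0, fun h0 => hF.ne_zero (by simp [h0]), by simp⟩
  by_cases hG0 : G.natDegree = 0
  · obtain ⟨d, rfl⟩ := Polynomial.natDegree_eq_zero.1 hG0
    exact ⟨d, 0, 1, fun h0 => hG.ne_zero (by simp [h0]), by simp⟩
  let _ := Classical.choice (inferInstance : Nonempty (NormalizedGCDMonoid R))
  have hFp := hF.isPrimitive hF0
  have hGp := hG.isPrimitive hG0
  let k := FractionRing R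
  have hF' : Irreducible (F.map (algebraMap R k)) :=
    (hFp.irreducible_iff_irreducible_map_fraction_map).1 hF
  have hcop : IsCoprime (F.map (algebraMap R k)) (G.map (algebraMap R k)) := by
    rw [hF'.coprime_iff_not_dvd]
    intro hdvd
    exact h (hF.associated_of_dvd hG (hFp.dvd_of_fraction_map_dvd_fraction_map (K := k) hdvd))
  obtain ⟨a, b, hab⟩ := hcop
  obtain ⟨c, hc, ha⟩ := IsLocalization.integerNormalization_spec (nonZeroDivisors R) a
  obtain ⟨e, he, hb⟩ := IsLocalization.integerNormalization_spec (nonZeroDivisors R) b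
  refine ⟨c * e, Polynomial.C e * IsLocalization.integerNormalization (nonZeroDivisors R) a,
    Polynomial.C c * IsLocalization.integerNormalization (nonZeroDivisors R) b,
    mul_ne_zero (nonZeroDivisors.ne_zero hc) (nonZeroDivisors.ne_zero he), ?_⟩
  apply Polynomial.map_injective (algebraMap R k) (IsFractionRing.injective R k)
  simp only [Polynomial.map_add, Polynomial.map_mul, Polynomial.map_C, ha, hb, map_mul]
  simp only [Algebra.smul_def, Polynomial.algebraMap_apply]
  linear_combination (Polynomial.C (algebraMap R k c) * Polynomial.C (algebraMap R k e)) * hab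

/-- A polynomial in two variables that vanishes on infinitely many lines through the origin is
zero. -/
theorem eq_zero_of_eval_lines {K : Type*} [Field K] [Infinite K] (d : MvPolynomial (Fin 2) K)
    {U : Set K} (hU : U.Infinite) (h : ∀ u ∈ U, ∀ t, eval ![t, t * u] d = 0) : d = 0 := by
  have key : ∀ t u, eval ![t, t * u] d = 0 := by
    intro t u
    let δ : Polynomial K := aeval ![Polynomial.C t, Polynomial.C t * Polynomial.X] d
    have hev : ∀ x, δ.eval x = eval ![t, t * x] d := by
      intro x
      have : (Polynomial.evalRingHom x).comp
          (aeval ![Polynomial.C t, Polynomial.C t * Polynomial.X] :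
            MvPolynomial (Fin 2) K →ₐ[K] Polynomial K).toRingHom = eval ![t, t * x] := by
        apply MvPolynomial.ringHom_ext
        · intro r; simp [← MvPolynomial.algebraMap_eq]
        · intro i; fin_cases i <;> simp
      exact congrArg (fun φ : MvPolynomial (Fin 2) K →+* K => φ d) this
    have hδ : δ = 0 := Polynomial.eq_zero_of_infinite_isRoot _
      (hU.mono fun u hu => by simp [Polynomial.IsRoot, hev, h u hu])
    rw [← hev, hδ, Polynomial.eval_zero]
  -- The lines `t ↦ (t, t * u)` miss only the points with vanishing first coordinate.
  have hX : X 0 * d = 0 := by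
    apply MvPolynomial.funext
    intro x
    by_cases h0 : x 0 = 0
    · simp [h0]
    · have hx : x = ![x 0, x 0 * (x 1 / x 0)] := by
        ext i; fin_cases i
        · simp
        · simp [mul_div_cancel₀ _ h0]
      rw [hx]; simp [key]
  simpa using hX

/-- The elimination step of the weak Bézout theorem, with the first variable eliminated. -/
theorem associated_of_common_zeros_aux {K : Type*} [Field K] [Infinite K]
    {f g : MvPolynomial (Fin 3) K} (hf : Irreducible f) (hg : Irreducible g)
    {U : Set K} (hU : U.Infinite)
    (h : ∀ u ∈ U, ∀ t, ∃ y, eval ![y, t, t * u] f = 0 ∧ eval ![y, t, t * u] g = 0) :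
    Associated f g := by
  by_contra hna
  let φ := finSuccEquiv K 2
  obtain ⟨d, A, B, hd, hAB⟩ := exists_mul_add_mul_eq_C_of_irreducible (F := φ f) (G := φ g)
    ((MulEquiv.irreducible_iff φ).2 hf) ((MulEquiv.irreducible_iff φ).2 hg)
    (fun h => hna (by simpa using h.map φ.symm))
  refine hd (eq_zero_of_eval_lines d hU fun u hu t => ?_)
  obtain ⟨y, hy1, hy2⟩ := h u hu t
  have e : (![y, t, t * u] : Fin 3 → K) = Fin.cons y ![t, t * u] := rfl
  rw [e, eval_eq_eval_mv_eval'] at hy1 hy2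
  have := congrArg (fun p => Polynomial.eval y (Polynomial.map (eval ![t, t * u]) p)) hAB
  simpa [φ, hy1, hy2] using this.symm

theorem aeval_smul_of_isHomogeneous {σ K L : Type*} [Field K] [Field L] [Algebra K L]
    {f : MvPolynomial σ K} {n : ℕ} (hf : f.IsHomogeneous n) (c : L) (x : σ → L) :
    aeval (c • x) f = c ^ n * aeval x f := by
  rw [aeval_def, aeval_def, eval₂_eq, eval₂_eq, Finset.mul_sum]
  refine Finset.sum_congr rfl fun s hs => ?_
  have hdeg : ∑ i ∈ s.support, s i = n := by
    have := hf (mem_support_iff.1 hs)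
    rwa [Finsupp.weight_apply, Finsupp.sum, Finset.sum_congr rfl (g := fun i => s i)
      (by simp)] at this
  simp only [Pi.smul_apply, smul_eq_mul, mul_pow, Finset.prod_mul_distrib,
    Finset.prod_pow_eq_pow_sum, hdeg]
  ring

/-- The weak Bézout theorem in the affine chart where the coordinate `a` is `1`, for common zeros
with infinitely many values of the coordinate `b`. -/
theorem associated_of_infinite_common_zeros {K : Type*} [Field K] [Infinite K]
    {f g : MvPolynomial (Fin 3) K} {m n : ℕ} (hfm : f.IsHomogeneous m) (hgn : g.IsHomogeneous n)
    (hf : Irreducible f) (hg : Irreducible g) {a b : Fin 3}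
    {Z : Set (Fin 3 → K)} (hZ : ∀ p ∈ Z, p a = 1 ∧ eval p f = 0 ∧ eval p g = 0)
    (hinf : ((fun p => p b) '' Z).Infinite) : Associated f g := by
  have hab : a ≠ b := by
    rintro rfl
    refine hinf ((Set.finite_singleton (1 : K)).subset ?_)
    rintro _ ⟨p, hp, rfl⟩
    exact (hZ p hp).1
  obtain ⟨σ, h1, h2⟩ : ∃ σ : Equiv.Perm (Fin 3), σ 1 = a ∧ σ 2 = b := by
    have : ∀ a b : Fin 3, a ≠ b → ∃ σ : Equiv.Perm (Fin 3), σ 1 = a ∧ σ 2 = b := by decide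
    exact this a b hab
  have key : Associated (renameEquiv K σ.symm f) (renameEquiv K σ.symm g) := by
    refine associated_of_common_zeros_aux ((MulEquiv.irreducible_iff (renameEquiv K σ.symm)).2 hf)
      ((MulEquiv.irreducible_iff (renameEquiv K σ.symm)).2 hg) hinf ?_
    rintro _ ⟨p, hp, rfl⟩ t
    obtain ⟨hp1, hp2, hp3⟩ := hZ p hp
    have e : (![t * p (σ 0), t, t * p b] ∘ σ.symm : Fin 3 → K) = t • p := by
      funext i
      obtain ⟨j, rfl⟩ := σ.surjective i
      rw [Function.comp_apply, Equiv.symm_apply_apply]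
      fin_cases j <;> simp [h1, h2, hp1]
    refine ⟨t * p (σ 0), ?_, ?_⟩
    · have := aeval_smul_of_isHomogeneous (L := K) hfm t p
      simp only [aeval_eq_eval] at this
      simp [eval_rename, e, this, hp2]
    · have := aeval_smul_of_isHomogeneous (L := K) hgn t p
      simp only [aeval_eq_eval] at this
      simp [eval_rename, e, this, hp3]
  have := key.map (renameEquiv K σ.symm).symm
  simpa only [AlgEquiv.symm_apply_apply] using this

/-! ### Derivatives and inflection points -/

/-- The chain rule for a derivation and a polynomial. -/
theorem derivation_aeval {R A σ : Type*} [CommRing R] [CommRing A] [Algebra R A] [Fintype σ]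
    (D : Derivation R A A) (w : σ → A) (f : MvPolynomial σ R) :
    D (aeval w f) = ∑ i, aeval w (pderiv i f) * D (w i) := by
  classical
  induction f using MvPolynomial.induction_on with
  | C a => simp
  | add p q hp hq => simp [hp, hq, add_mul, Finset.sum_add_distrib]
  | mul_X p i hp =>
    simp only [map_mul, aeval_X, Derivation.leibniz, hp, smul_eq_mul, pderiv_X, map_add,
      add_mul, Finset.sum_add_distrib, Finset.mul_sum]
    congr 1
    · rw [Finset.sum_eq_single i]
      · simp
      · intro j _ hj; simp [hj.symm]
      · simp
    · exact Finset.sum_congr rfl fun j _ => by ring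

theorem pderiv_comm {R σ : Type*} [CommRing R] (i j : σ) (f : MvPolynomial σ R) :
    pderiv i (pderiv j f) = pderiv j (pderiv i f) := by
  classical
  have h : ⁅(pderiv i : Derivation R (MvPolynomial σ R) (MvPolynomial σ R)),
      (pderiv j : Derivation R (MvPolynomial σ R) (MvPolynomial σ R))⁆ = 0 :=
    derivation_ext fun k => by
      rw [Derivation.commutator_apply, pderiv_X, pderiv_X, Pi.single_apply, Pi.single_apply]
      split_ifs <;> simp
  have hf := congrArg (fun D : Derivation R (MvPolynomial σ R) (MvPolynomial σ R) => D f) h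
  rwa [Derivation.commutator_apply, Derivation.zero_apply, sub_eq_zero] at hf

/-- The vector `p` has a *flex direction* for `f`: a vector `v`, not proportional to `p`, that is
tangent to `f = 0` at `p` and at which the Hessian form of `f` at `p` vanishes. It differs from
`IsInflectionPoint` in making sense over any extension of the field of coefficients, and in being
expressed by polynomial identities in the coordinates. -/
def IsFlex {K L : Type*} [Field K] [Field L] [Algebra K L] (f : MvPolynomial (Fin 3) K)
    (p : Fin 3 → L) : Prop :=
  ∃ v : Fin 3 → L, (∃ i j, p i * v j ≠ p j * v i) ∧
    ∑ i, aeval p (pderiv i f) * v i = 0 ∧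
    ∑ i, ∑ j, aeval p (pderiv j (pderiv i f)) * v i * v j = 0

/-- Euler's identity, evaluated at a point. -/
theorem sum_aeval_pderiv_mul_self {K L : Type*} [Field K] [Field L] [Algebra K L]
    {f : MvPolynomial (Fin 3) K} {m : ℕ} (hf : f.IsHomogeneous m) (p : Fin 3 → L) :
    ∑ i, aeval p (pderiv i f) * p i = m * aeval p f := by
  have := congrArg (aeval p) hf.sum_X_mul_pderiv
  simpa [mul_comm] using this

/-- Two independent vectors of the plane `a · x = 0` span it. -/
theorem exists_eq_add_of_mem_plane {K : Type*} [Field K] {a p v q : Fin 3 → K} (ha : ∃ i, a i ≠ 0)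
    (hp : ∑ i, a i * p i = 0) (hv : ∑ i, a i * v i = 0) (hq : ∑ i, a i * q i = 0)
    (hpv : ∃ i j, p i * v j ≠ p j * v i) : ∃ α β : K, ∀ i, q i = α * p i + β * v i := by
  obtain ⟨i₀, hi₀⟩ := ha
  have hdet : (Matrix.of ![p, v, q]).det = 0 := by
    apply Matrix.exists_mulVec_eq_zero_iff.1
    refine ⟨a, fun h => hi₀ (congrFun h i₀), ?_⟩
    ext i
    fin_cases i <;> simp [Matrix.mulVec, dotProduct, mul_comm, hp, hv, hq]
  obtain ⟨w, hw, hwM⟩ := Matrix.exists_vecMul_eq_zero_iff.2 hdet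
  have hrel : ∀ i, w 0 * p i + w 1 * v i + w 2 * q i = 0 := by
    intro i
    have := congrFun hwM i
    simpa [Matrix.vecMul, dotProduct, Fin.sum_univ_three] using this
  obtain ⟨i, j, hij⟩ := hpv
  have h2 : w 2 ≠ 0 := by
    intro h2
    simp only [h2, zero_mul, add_zero] at hrel
    have e : p i * v j - p j * v i ≠ 0 := sub_ne_zero.2 hij
    have h0 : w 0 = 0 := by
      refine (mul_eq_zero.1 ?_).resolve_right e
      linear_combination v j * hrel i - v i * hrel j
    have h1 : w 1 = 0 := by
      refine (mul_eq_zero.1 ?_).resolve_right e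
      linear_combination p i * hrel j - p j * hrel i
    exact hw (by ext k; fin_cases k <;> simp [h0, h1, h2])
  refine ⟨-(w 0 / w 2), -(w 1 / w 2), fun i => ?_⟩
  field_simp
  linear_combination hrel i

/-- By Euler's identity for `f` and for its partial derivatives, the Hessian form vanishes on the
whole plane of `P.rep` and `v`, that is, on the tangent line. The form is
twice the coefficient of `t ^ 2` in `f (P + t Q)`, so characteristic `2` has to be excluded. -/
theorem IsFlex.isInflectionPoint {K : Type*} [Field K] (h2 : (2 : K) ≠ 0)
    {f : MvPolynomial (Fin 3) K} {m : ℕ} (hf : f.IsHomogeneous m) {P : Plane K}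
    (hP : IsSimplePoint f P) (h : IsFlex f P.rep) : IsInflectionPoint f P := by
  refine ⟨hP, fun Q hQ _ => ?_⟩
  obtain ⟨v, hpv, hv1, hv2⟩ := h
  set p := P.rep
  set q := Q.rep with hqdef
  have hP0 : aeval p f = 0 := by rw [aeval_eq_eval]; exact hP.1
  have hP1 : ∃ i, aeval p (pderiv i f) ≠ 0 := by
    simpa only [aeval_eq_eval, RingHom.coe_coe] using hP.2
  have hq1 : ∑ i, aeval p (pderiv i f) * q i = 0 := by
    rw [aeval_eq_eval]; exact hQ
  have hp1 : ∑ i, aeval p (pderiv i f) * p i = 0 := by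
    rw [sum_aeval_pderiv_mul_self hf, hP0, mul_zero]
  have hHp : ∀ i, ∑ j, aeval p (pderiv j (pderiv i f)) * p j =
      ((m - 1 : ℕ) : K) * aeval p (pderiv i f) := fun i =>
    sum_aeval_pderiv_mul_self (hf.pderiv) p
  have hsymm : ∀ i j, aeval p (pderiv j (pderiv i f)) = aeval p (pderiv i (pderiv j f)) := by
    intro i j
    rw [pderiv_comm]
  obtain ⟨α, β, hαβ⟩ := exists_eq_add_of_mem_plane hP1 hp1 hv1 hq1 hpv
  have hq2 : ∑ i, ∑ j, aeval p (pderiv j (pderiv i f)) * q i * q j = 0 := by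
    have e0 := hHp 0
    have e1 := hHp 1
    have e2 := hHp 2
    simp only [hαβ] at hq1 ⊢
    simp only [Fin.sum_univ_three, hsymm 1 0, hsymm 2 0, hsymm 2 1] at hv1 hv2 hq1 e0 e1 e2 ⊢
    linear_combination (exp := 1) α * ((α * p 0 + β * v 0) * e0 + (α * p 1 + β * v 1) * e1
      + (α * p 2 + β * v 2) * e2) + α * β * (v 0 * e0 + v 1 * e1 + v 2 * e2) + β ^ 2 * hv2
      + ((m - 1 : ℕ) : K) * (α * hq1 + α * β * hv1)
  set w : Fin 3 → Polynomial K := fun i => Polynomial.C (p i) + Polynomial.X * Polynomial.C (q i)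
  have hw0 : ∀ h : MvPolynomial (Fin 3) K, (aeval w h).coeff 0 = aeval p h := by
    intro h
    rw [Polynomial.coeff_zero_eq_aeval_zero, ← AlgHom.comp_apply, comp_aeval]
    simp [w]
  have hD : ∀ h : MvPolynomial (Fin 3) K, Polynomial.derivative (aeval w h) =
      ∑ i, aeval w (pderiv i h) * Polynomial.C (q i) := by
    intro h
    have := derivation_aeval Polynomial.derivative' w h
    simpa [w] using this
  unfold lineMultiplicity
  change ((3 : ℕ) : ℕ∞) ≤ emultiplicity _ (aeval w f)
  rw [← pow_dvd_iff_le_emultiplicity, Polynomial.X_pow_dvd_iff]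
  have c1 : (aeval w f).coeff 1 = 0 := by
    have := congrArg (fun r => Polynomial.coeff r 0) (hD f)
    simpa only [Polynomial.coeff_derivative, Polynomial.finsetSum_coeff, Polynomial.coeff_mul_C,
      hw0, hq1, zero_add, Nat.cast_zero, mul_one] using this
  have c2 : (aeval w f).coeff 2 = 0 := by
    have hDD : Polynomial.derivative (Polynomial.derivative (aeval w f)) =
        ∑ i, ∑ j, aeval w (pderiv j (pderiv i f)) * Polynomial.C (q j) * Polynomial.C (q i) := by
      simp only [hD, Polynomial.derivative_sum, Polynomial.derivative_mul, Polynomial.derivative_C,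
        mul_zero, add_zero, Finset.sum_mul]
    have := congrArg (fun r => Polynomial.coeff r 0) hDD
    simp only [Polynomial.coeff_derivative, Polynomial.finsetSum_coeff, Polynomial.coeff_mul_C,
      hw0] at this
    have h0 : (aeval w f).coeff 2 * 2 = 0 := by
      rw [← hq2]
      calc _ = _ := by norm_num
        _ = _ := this
        _ = _ := by simp only [mul_right_comm]
    exact (mul_eq_zero.1 h0).resolve_right h2
  intro d hd
  interval_cases d
  · rw [hw0, hP0]
  · exact c1
  · exact c2

/-! ### Common tangents at a generic point -/

/-- Without nonzero derivations `E` would be unramified over `K`, hence finite separable, hence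
equal to `K`. -/
theorem exists_derivation_ne_zero {K E : Type*} [Field K] [IsAlgClosed K] [Field E] [Algebra K E]
    [Algebra.EssFiniteType K E] {x : E} (hx : x ∉ Set.range (algebraMap K E)) :
    ∃ D : Derivation K E E, D ≠ 0 := by
  by_contra! h
  have hsub : Subsingleton (Ω[E⁄K]) := by
    rw [← not_nontrivial_iff_subsingleton]
    intro hnt
    obtain ⟨y, hy⟩ := exists_ne (0 : Ω[E⁄K])
    obtain ⟨φ, hφ⟩ := Module.Projective.exists_dual_ne_zero E hy
    have h0 := h (KaehlerDifferential.linearMapEquivDerivation K E φ)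
    rw [LinearEquiv.map_eq_zero_iff] at h0
    exact hφ (by rw [h0, LinearMap.zero_apply])
  have : Algebra.FormallyUnramified K E := ⟨hsub⟩
  have := Algebra.FormallyUnramified.isSeparable K E
  exact hx ((IsAlgClosed.algebraMap_bijective_of_isIntegral (k := K) (K := E)).2 x)

theorem derivation_eq_zero_of_adjoin {K L : Type*} [Field K] [Field L] [Algebra K L] {s : Set L}
    (D : Derivation K (IntermediateField.adjoin K s) (IntermediateField.adjoin K s))
    (h : ∀ x (hx : x ∈ s), D ⟨x, IntermediateField.subset_adjoin K s hx⟩ = 0) : D = 0 := by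
  ext ⟨x, hx⟩ : 1
  induction hx using IntermediateField.adjoin_induction with
  | mem x hx => exact h x hx
  | algebraMap x => exact D.map_algebraMap x
  | add x y hx hy h1 h2 =>
    have := D.map_add ⟨x, hx⟩ ⟨y, hy⟩
    rw [h1, h2] at this
    simpa using this
  | inv x hx h1 =>
    have := D.leibniz_inv ⟨x, hx⟩
    rw [h1, Derivation.zero_apply, smul_zero] at this
    exact this
  | mul x y hx hy h1 h2 =>
    have := D.leibniz ⟨x, hx⟩ ⟨y, hy⟩
    rw [h1, h2] at this
    simpa using this

/-- Two distinct lines meet in one point. The normalization of `l` and `l'` at the coordinate `c`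
reduces their independence to `l' ≠ 0`. -/
theorem proportional_of_mem_two_lines {L : Type*} [Field L] {l l' p q : Fin 3 → L} {c : Fin 3}
    (hc : l c = 1) (hc' : l' c = 0) (hl' : ∃ j, l' j ≠ 0)
    (hp : ∑ i, l i * p i = 0) (hp' : ∑ i, l' i * p i = 0)
    (hq : ∑ i, l i * q i = 0) (hq' : ∑ i, l' i * q i = 0) : ∀ i j, p i * q j = p j * q i := by
  by_contra! hpq
  obtain ⟨j, hj⟩ := hl'
  -- The vector `e_j - l_j e_c` is killed by `l`, and `l'` takes the value `l' j` at it.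
  have hx : ∑ i, l i * (Pi.single j 1 - l j • Pi.single c 1 : Fin 3 → L) i = 0 := by
    simp [mul_sub, Finset.sum_sub_distrib, Pi.single_apply, hc]
  obtain ⟨α, β, hαβ⟩ := exists_eq_add_of_mem_plane ⟨c, by simp [hc]⟩ hp hq hx hpq
  have hx' : ∑ i, l' i * (Pi.single j 1 - l j • Pi.single c 1 : Fin 3 → L) i = l' j := by
    simp [mul_sub, Finset.sum_sub_distrib, Pi.single_apply, hc']
  apply hj
  rw [← hx']
  simp only [hαβ, Fin.sum_univ_three] at hp' hq' ⊢
  linear_combination α * hp' + β * hq'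

section Derivation

variable {K L : Type*} [Field K] [Field L] [Algebra K L] (D : Derivation K L L)

/-- The dual incidence relation: if `l` is the tangent at `p`, then `D l` also vanishes at `p`. -/
theorem sum_derivation_mul_eq_zero {f : MvPolynomial (Fin 3) K} {m : ℕ} (hf : f.IsHomogeneous m)
    {p l : Fin 3 → L} {r : L} (hr : r ≠ 0) (hl : ∀ i, aeval p (pderiv i f) = r * l i)
    (hp : aeval p f = 0) : ∑ i, l i * p i = 0 ∧ ∑ i, D (l i) * p i = 0 := by
  have h1 : ∑ i, l i * p i = 0 := by
    have := sum_aeval_pderiv_mul_self hf p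
    simp only [hl, hp, mul_zero, mul_assoc, ← Finset.mul_sum] at this
    exact (mul_eq_zero.1 this).resolve_left hr
  have h2 : ∑ i, l i * D (p i) = 0 := by
    have := derivation_aeval D p f
    simp only [hl, hp, map_zero, mul_assoc, ← Finset.mul_sum] at this
    exact (mul_eq_zero.1 this.symm).resolve_left hr
  refine ⟨h1, ?_⟩
  have := congrArg D h1
  simp only [map_sum, Derivation.leibniz, smul_eq_mul, Finset.sum_add_distrib, h2, map_zero,
    zero_add] at this
  simpa only [mul_comm] using this

/-- If the tangent at `p` is constant for `D` and `p` is not, then `D p` is a flex direction. -/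
theorem isFlex_of_derivation {f : MvPolynomial (Fin 3) K} {p l : Fin 3 → L} {r : L}
    (hr : r ≠ 0) (hl : ∀ i, aeval p (pderiv i f) = r * l i) (hp : aeval p f = 0) {a : Fin 3}
    (ha : p a = 1) (hDl : ∀ i, D (l i) = 0) (hDp : ∃ i, D (p i) ≠ 0) : IsFlex f p := by
  have h1 : ∑ i, aeval p (pderiv i f) * D (p i) = 0 := by
    rw [← derivation_aeval, hp, map_zero]
  obtain ⟨i, hi⟩ := hDp
  refine ⟨fun i => D (p i), ⟨a, i, by simpa [ha] using hi⟩, h1, ?_⟩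
  have h2 : ∀ i, ∑ j, aeval p (pderiv j (pderiv i f)) * D (p j) = D r * l i := by
    intro i
    rw [← derivation_aeval, hl, Derivation.leibniz, hDl]
    simp [mul_comm]
  simp only [hl, mul_assoc, ← Finset.mul_sum] at h1
  have h3 := (mul_eq_zero.1 h1).resolve_left hr
  calc _ = ∑ i, (∑ j, aeval p (pderiv j (pderiv i f)) * D (p j)) * D (p i) := by
        simp only [Finset.sum_mul, mul_right_comm]
    _ = D r * ∑ i, l i * D (p i) := by simp only [h2, mul_assoc, Finset.mul_sum]
    _ = 0 := by rw [h3, mul_zero]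

/-- The alternative between biduality and flexes, for normalized points on which a given derivation
is nonzero. -/
theorem proportional_or_isFlex_of_derivation {f g : MvPolynomial (Fin 3) K} {m n : ℕ}
    (hf : f.IsHomogeneous m) (hg : g.IsHomogeneous n) {p q : Fin 3 → L}
    {a b : Fin 3} (ha : p a = 1) (hb : q b = 1) (hp : aeval p f = 0) (hq : aeval q g = 0)
    (hfp : ∃ i, aeval p (pderiv i f) ≠ 0) (hgq : ∃ i, aeval q (pderiv i g) ≠ 0)
    (hfg : ∀ i j, aeval p (pderiv i f) * aeval q (pderiv j g) =
      aeval p (pderiv j f) * aeval q (pderiv i g))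
    (hD : (∃ i, D (p i) ≠ 0) ∨ ∃ i, D (q i) ≠ 0) :
    (∀ i j, p i * q j = p j * q i) ∨ IsFlex f p ∨ IsFlex g q := by
  obtain ⟨c, hc⟩ := hfp
  set r := aeval p (pderiv c f)
  set s := aeval q (pderiv c g)
  set l : Fin 3 → L := fun i => aeval p (pderiv i f) / r with hl
  have hlc : l c = 1 := div_self hc
  have hlf : ∀ i, aeval p (pderiv i f) = r * l i := fun i => by simp [hl, mul_div_cancel₀ _ hc]
  have hlg : ∀ i, aeval q (pderiv i g) = s * l i := fun i => by
    simp only [hl]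
    field_simp
    linear_combination hfg c i
  have hs : s ≠ 0 := by
    intro hs
    obtain ⟨i, hi⟩ := hgq
    exact hi (by rw [hlg, hs, zero_mul])
  obtain ⟨hp1, hp2⟩ := sum_derivation_mul_eq_zero D hf hc hlf hp
  obtain ⟨hq1, hq2⟩ := sum_derivation_mul_eq_zero D hg hs hlg hq
  by_cases hDl : ∃ i, D (l i) ≠ 0
  · exact .inl (proportional_of_mem_two_lines (l' := fun i => D (l i)) hlc (by simp [hlc]) hDl
      hp1 hp2 hq1 hq2)
  · push Not at hDl
    exact .inr (hD.imp (isFlex_of_derivation D hc hlf hp ha hDl)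
      (isFlex_of_derivation D hs hlg hq hb hDl))

end Derivation

theorem IsFlex.of_algebraMap {K E L : Type*} [Field K] [Field E] [Field L] [Algebra K E]
    [Algebra K L] [Algebra E L] [IsScalarTower K E L] {f : MvPolynomial (Fin 3) K}
    {p : Fin 3 → E} (h : IsFlex f p) : IsFlex f (algebraMap E L ∘ p) := by
  obtain ⟨v, ⟨i, j, hij⟩, h1, h2⟩ := h
  have ev : ∀ h : MvPolynomial (Fin 3) K, aeval (algebraMap E L ∘ p) h =
      algebraMap E L (aeval p h) := fun h => aeval_algebraMap_apply L p h
  refine ⟨algebraMap E L ∘ v, ⟨i, j, ?_⟩, ?_, ?_⟩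
  · simpa only [Function.comp_apply, ← map_mul] using (algebraMap E L).injective.ne hij
  · have := congrArg (algebraMap E L) h1
    simpa only [map_sum, map_mul, map_zero, ← ev, Function.comp_apply] using this
  · have := congrArg (algebraMap E L) h2
    simpa only [map_sum, map_mul, map_zero, ← ev, Function.comp_apply] using this

theorem IsFlex.of_smul {K L : Type*} [Field K] [Field L] [Algebra K L]
    {f : MvPolynomial (Fin 3) K} {m : ℕ} (hf : f.IsHomogeneous m) {p : Fin 3 → L} {c : L}
    (hc : c ≠ 0) (h : IsFlex f (c • p)) : IsFlex f p := by
  obtain ⟨v, ⟨i, j, hij⟩, h1, h2⟩ := h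
  refine ⟨v, ⟨i, j, fun h => hij ?_⟩, ?_, ?_⟩
  · simp only [Pi.smul_apply, smul_eq_mul, mul_assoc, h]
  · simp only [aeval_smul_of_isHomogeneous hf.pderiv, mul_assoc, ← Finset.mul_sum] at h1
    exact (mul_eq_zero.1 h1).resolve_left (pow_ne_zero _ hc)
  · simp only [aeval_smul_of_isHomogeneous hf.pderiv.pderiv, mul_assoc, ← Finset.mul_sum] at h2
    simpa only [mul_assoc] using (mul_eq_zero.1 h2).resolve_left (pow_ne_zero _ hc)

/-- Let `p` and `q` be points of `f = 0` and `g = 0` over an extension `L` of the algebraically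
closed field `K`, with a common tangent. If `p` is not a `K`-point, then `p` and `q` are the same point
or one of them is a flex. -/
theorem proportional_or_isFlex {K L : Type*} [Field K] [IsAlgClosed K] [Field L] [Algebra K L]
    {f g : MvPolynomial (Fin 3) K} {m n : ℕ}
    (hf : f.IsHomogeneous m) (hg : g.IsHomogeneous n) {p q : Fin 3 → L}
    (hp0 : p ≠ 0) (hq0 : q ≠ 0) (hp : aeval p f = 0) (hq : aeval q g = 0)
    (hfp : ∃ i, aeval p (pderiv i f) ≠ 0) (hgq : ∃ i, aeval q (pderiv i g) ≠ 0)
    (hfg : ∀ i j, aeval p (pderiv i f) * aeval q (pderiv j g) =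
      aeval p (pderiv j f) * aeval q (pderiv i g))
    (hnc : ∀ (c : L) (k : Fin 3 → K), p ≠ c • (algebraMap K L ∘ k)) :
    (∀ i j, p i * q j = p j * q i) ∨ IsFlex f p ∨ IsFlex g q := by
  obtain ⟨a, ha⟩ := Function.ne_iff.1 hp0
  obtain ⟨b, hb⟩ := Function.ne_iff.1 hq0
  rw [Pi.zero_apply] at ha hb
  have ha' := inv_ne_zero ha
  have hb' := inv_ne_zero hb
  set P : Fin 3 → L := (p a)⁻¹ • p with hP
  set Q : Fin 3 → L := (q b)⁻¹ • q with hQ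
  let E := IntermediateField.adjoin K (Set.range P ∪ Set.range Q)
  have hPm : ∀ i, P i ∈ E := fun i =>
    IntermediateField.subset_adjoin K _ (.inl ⟨i, rfl⟩)
  have hQm : ∀ i, Q i ∈ E := fun i =>
    IntermediateField.subset_adjoin K _ (.inr ⟨i, rfl⟩)
  let P' : Fin 3 → E := fun i => ⟨P i, hPm i⟩
  let Q' : Fin 3 → E := fun i => ⟨Q i, hQm i⟩
  have hP' : algebraMap E L ∘ P' = P := rfl
  have hQ' : algebraMap E L ∘ Q' = Q := rfl
  have evP : ∀ h : MvPolynomial (Fin 3) K, algebraMap E L (aeval P' h) = aeval P h := fun h => by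
    rw [← hP']; exact (aeval_algebraMap_apply L P' h).symm
  have evQ : ∀ h : MvPolynomial (Fin 3) K, algebraMap E L (aeval Q' h) = aeval Q h := fun h => by
    rw [← hQ']; exact (aeval_algebraMap_apply L Q' h).symm
  have inj := (algebraMap E L).injective
  have : Algebra.EssFiniteType K E :=
    IntermediateField.essFiniteType_iff.2
      (IntermediateField.fg_adjoin_of_finite ((Set.finite_range P).union (Set.finite_range Q)))
  obtain ⟨i₀, hi₀⟩ : ∃ i, P i ∉ Set.range (algebraMap K L) := by
    by_contra! h
    choose k hk using h
    refine hnc (p a) k ?_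
    rw [show algebraMap K L ∘ k = P from funext hk, hP, smul_smul, mul_inv_cancel₀ ha, one_smul]
  have hx : P' i₀ ∉ Set.range (algebraMap K E) := by
    rintro ⟨x, hx⟩
    exact hi₀ ⟨x, congrArg (algebraMap E L) hx⟩
  obtain ⟨D, hD⟩ := exists_derivation_ne_zero hx
  have hD' : (∃ i, D (P' i) ≠ 0) ∨ ∃ i, D (Q' i) ≠ 0 := by
    by_contra! h
    refine hD (derivation_eq_zero_of_adjoin D ?_)
    rintro _ (⟨i, rfl⟩ | ⟨i, rfl⟩)
    · exact h.1 i
    · exact h.2 i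
  have main := proportional_or_isFlex_of_derivation D hf hg (p := P') (q := Q') (a := a) (b := b)
    (inj (inv_mul_cancel₀ ha)) (inj (inv_mul_cancel₀ hb))
    (inj (by rw [evP, aeval_smul_of_isHomogeneous hf, hp, mul_zero, map_zero]))
    (inj (by rw [evQ, aeval_smul_of_isHomogeneous hg, hq, mul_zero, map_zero]))
    (by
      obtain ⟨i, hi⟩ := hfp
      refine ⟨i, fun h => ?_⟩
      have := congrArg (algebraMap E L) h
      rw [evP, aeval_smul_of_isHomogeneous hf.pderiv, map_zero] at this
      exact mul_ne_zero (pow_ne_zero _ ha') hi this)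
    (by
      obtain ⟨i, hi⟩ := hgq
      refine ⟨i, fun h => ?_⟩
      have := congrArg (algebraMap E L) h
      rw [evQ, aeval_smul_of_isHomogeneous hg.pderiv, map_zero] at this
      exact mul_ne_zero (pow_ne_zero _ hb') hi this)
    (fun i j => inj (by
      simp only [map_mul, evP, evQ, P, Q, aeval_smul_of_isHomogeneous hf.pderiv,
        aeval_smul_of_isHomogeneous hg.pderiv]
      linear_combination ((p a)⁻¹ ^ (m - 1) * (q b)⁻¹ ^ (n - 1)) * hfg i j)) hD'
  refine main.imp (fun h i j => ?_) (Or.imp (fun h => ?_) fun h => ?_)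
  · have := congrArg (algebraMap E L) (h i j)
    have : (p a)⁻¹ * p i * ((q b)⁻¹ * q j) = (p a)⁻¹ * p j * ((q b)⁻¹ * q i) := this
    refine mul_left_cancel₀ (mul_ne_zero ha' hb') ?_
    linear_combination this
  · exact (h.of_algebraMap (L := L)).of_smul hf ha'
  · exact (h.of_algebraMap (L := L)).of_smul hg hb'

/-! ### Points and lines of the projective plane -/

theorem eq_of_rep_proportional {K : Type*} [Field K] {P Q : Plane K}
    (h : ∀ i j, P.rep i * Q.rep j = P.rep j * Q.rep i) : P = Q := by
  obtain ⟨j, hj⟩ := Function.ne_iff.1 Q.rep_nonzero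
  rw [← P.mk_rep, ← Q.mk_rep, Projectivization.mk_eq_mk_iff']
  refine ⟨P.rep j / Q.rep j, funext fun i => ?_⟩
  rw [Pi.zero_apply] at hj
  simp only [Pi.smul_apply, smul_eq_mul]
  field_simp
  linear_combination -h i j

/-- Linear forms defining the same set of points of the plane are proportional. -/
theorem proportional_of_line_eq {K : Type*} [Field K] {a b : Fin 3 → K}
    (h : {Q : Plane K | ∑ i, a i * Q.rep i = 0} = {Q : Plane K | ∑ i, b i * Q.rep i = 0})
    (i j : Fin 3) : a i * b j = a j * b i := by
  -- Unless `v = 0`, it represents the point where the line of `a` meets the line spanned by the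
  -- basis vectors `i` and `j`.
  set v : Fin 3 → K := Pi.single i (a j) - Pi.single j (a i) with hv
  have hsum : ∀ c : Fin 3 → K, ∑ k, c k * v k = c i * a j - c j * a i := fun c => by
    simp [hv, mul_sub, Finset.sum_sub_distrib, Pi.single_apply]
  suffices hb : ∑ k, b k * v k = 0 by
    rw [hsum] at hb
    linear_combination -hb
  by_cases hv0 : v = 0
  · simp [hv0]
  obtain ⟨c, hc⟩ := Projectivization.exists_smul_eq_mk_rep K v hv0
  have hmem : ∀ d : Fin 3 → K, ∑ k, d k * (Projectivization.mk K v hv0).rep k =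
      c * ∑ k, d k * v k := fun d => by
    rw [← hc, Finset.mul_sum]
    exact Finset.sum_congr rfl fun k _ => by
      rw [Pi.smul_apply, Units.smul_def, smul_eq_mul]; ring
  have hQ : Projectivization.mk K v hv0 ∈ {Q : Plane K | ∑ i, b i * Q.rep i = 0} := by
    rw [← h, Set.mem_ofPred_eq, hmem, hsum]
    ring
  rw [Set.mem_ofPred_eq, hmem] at hQ
  exact (mul_eq_zero.1 hQ).resolve_left c.ne_zero

/-- A weak form of Bézout's theorem: two irreducible plane curves with infinitely many common points
coincide. -/
theorem associated_of_infinite_inter {K : Type*} [Field K] [Infinite K]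
    {f g : MvPolynomial (Fin 3) K} {m n : ℕ} (hfm : f.IsHomogeneous m) (hgn : g.IsHomogeneous n)
    (hf : Irreducible f) (hg : Irreducible g)
    (hinf : (zeroLocus f ∩ zeroLocus g).Infinite) : Associated f g := by
  by_contra hna
  set Z := zeroLocus f ∩ zeroLocus g
  let N : Fin 3 → Plane K → Fin 3 → K := fun a P => (P.rep a)⁻¹ • P.rep
  have hfin : ∀ a b, ((fun p => p b) '' (N a '' {P ∈ Z | P.rep a ≠ 0})).Finite := by
    intro a b
    by_contra hab
    refine hna (associated_of_infinite_common_zeros hfm hgn hf hg (a := a) ?_ hab)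
    rintro _ ⟨P, ⟨⟨hPf, hPg⟩, hPa⟩, rfl⟩
    have e1 := aeval_smul_of_isHomogeneous (L := K) hfm (P.rep a)⁻¹ P.rep
    have e2 := aeval_smul_of_isHomogeneous (L := K) hgn (P.rep a)⁻¹ P.rep
    have z1 : eval P.rep f = 0 := hPf
    have z2 : eval P.rep g = 0 := hPg
    rw [aeval_eq_eval, aeval_eq_eval] at e1 e2
    exact ⟨inv_mul_cancel₀ hPa, by rw [e1, z1, mul_zero], by rw [e2, z2, mul_zero]⟩
  refine hinf (Set.Finite.subset (s := ⋃ a, {P ∈ Z | P.rep a ≠ 0})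
    (Set.finite_iUnion fun a => ?_) fun P hP => ?_)
  · refine Set.Finite.of_finite_image (f := N a)
      ((Set.Finite.pi fun b => hfin a b).subset fun p hp b _ => ⟨p, hp, rfl⟩) ?_
    rintro P ⟨-, hP⟩ Q ⟨-, hQ⟩ hPQ
    refine eq_of_rep_proportional fun i j => ?_
    have ei : (P.rep a)⁻¹ * P.rep i = (Q.rep a)⁻¹ * Q.rep i := congrFun hPQ i
    have ej : (P.rep a)⁻¹ * P.rep j = (Q.rep a)⁻¹ * Q.rep j := congrFun hPQ j
    refine mul_left_cancel₀ (inv_ne_zero hP) ?_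
    linear_combination Q.rep j * ei - Q.rep i * ej
  · obtain ⟨a, ha⟩ := Function.ne_iff.1 P.rep_nonzero
    exact Set.mem_iUnion.2 ⟨a, hP, ha⟩

/-! ### Ultrapowers of a field -/

section Ultrapower

variable {S K : Type*} [Field K]

/-- The diagonal embedding makes the ultrapower an algebra over the base field. -/
instance germAlgebra (U : Ultrafilter S) : Algebra K (Germ (U : Filter S) K) where
  algebraMap := (Germ.coeRingHom (U : Filter S)).comp (Pi.constRingHom S K)
  commutes' _ _ := mul_comm _ _
  smul_def' _ x := Germ.inductionOn x fun _ => rfl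

/-- The projection of the functions `S → K` onto the ultrapower, as a map of `K`-algebras. -/
def germAlgHom (U : Ultrafilter S) : (S → K) →ₐ[K] Germ (U : Filter S) K where
  __ := Germ.coeRingHom (U : Filter S)
  commutes' _ := rfl

variable {U : Ultrafilter S}

theorem germAlgHom_eq_iff {x y : S → K} :
    germAlgHom U x = germAlgHom U y ↔ ∀ᶠ s in U, x s = y s := Germ.coe_eq

theorem germAlgHom_eq_zero_iff {x : S → K} : germAlgHom U x = 0 ↔ ∀ᶠ s in U, x s = 0 := by
  rw [← map_zero (germAlgHom (K := K) U), germAlgHom_eq_iff]; rfl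

theorem germAlgHom_surjective : Function.Surjective (germAlgHom (K := K) U) :=
  fun x => Germ.inductionOn x fun y => ⟨y, rfl⟩

theorem aeval_germ (p : Fin 3 → S → K) (h : MvPolynomial (Fin 3) K) :
    aeval (fun i => germAlgHom U (p i)) h =
      germAlgHom U (fun s => eval (fun i => p i s) h) := by
  have e : aeval p h = fun s => eval (fun i => p i s) h := by
    funext s
    have := congrArg (fun φ => φ h) (comp_aeval (R := K) p (Pi.evalAlgHom K (fun _ : S => K) s))
    simpa [aeval_eq_eval] using this
  rw [← e, ← AlgHom.comp_apply, comp_aeval]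

/-- Łoś's theorem for the property of being a flex. -/
theorem IsFlex.eventually {f : MvPolynomial (Fin 3) K} {p : Fin 3 → S → K}
    (h : IsFlex f (fun i => germAlgHom U (p i))) : ∀ᶠ s in U, IsFlex f (fun i => p i s) := by
  obtain ⟨v, ⟨i, j, hij⟩, h1, h2⟩ := h
  choose w hw using fun i => germAlgHom_surjective (v i)
  obtain rfl : (fun i => germAlgHom U (w i)) = v := funext hw
  simp only [aeval_germ, ← map_mul, ← map_sum, germAlgHom_eq_zero_iff] at h1 h2
  simp only [← map_mul, Ne, germAlgHom_eq_iff, ← Ultrafilter.eventually_not] at hij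
  filter_upwards [hij, h1, h2] with s hs hs1 hs2
  refine ⟨fun i => w i s, ⟨i, j, hs⟩, ?_, ?_⟩
  · simpa [aeval_eq_eval] using hs1
  · simpa [aeval_eq_eval] using hs2

end Ultrapower

/-! ### Finiteness of the set of common tangents -/

theorem finite_common_tangents {K : Type*} [Field K] [IsAlgClosed K] (h2 : (2 : K) ≠ 0)
    {f g : MvPolynomial (Fin 3) K} {m n : ℕ} (hf : f.IsHomogeneous m) (hg : g.IsHomogeneous n)
    (hf_irr : Irreducible f) (hg_irr : Irreducible g) (hne : zeroLocus f ≠ zeroLocus g)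
    (hf_infl : {P | IsInflectionPoint f P}.Finite)
    (hg_infl : {P | IsInflectionPoint g P}.Finite) :
    {L : Set (Plane K) | IsTangent f L ∧ IsTangent g L}.Finite := by
  by_contra hinf
  set T := {L : Set (Plane K) | IsTangent f L ∧ IsTangent g L}
  have : Infinite T := Set.infinite_coe_iff.2 hinf
  have hT : ∀ L : T, ∃ P Q, IsSimplePoint f P ∧ IsSimplePoint g Q ∧ L = tangentLine f P ∧
      L = tangentLine g Q := by
    rintro ⟨L, ⟨P, hP, hLP⟩, ⟨Q, hQ, hLQ⟩⟩
    exact ⟨P, Q, hP, hQ, hLP, hLQ⟩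
  choose P Q hP hQ hLP hLQ using hT
  have hPinj : Function.Injective P := fun L L' h => Subtype.ext (by rw [hLP, hLP, h])
  have hQinj : Function.Injective Q := fun L L' h => Subtype.ext (by rw [hLQ, hLQ, h])
  let U := hyperfilter T
  have hU : ∀ {p : T → Prop}, (∀ᶠ s in U, p s) → {s | p s}.Infinite := fun hp hfin =>
    notMem_hyperfilter_of_finite hfin hp
  let p : Fin 3 → T → K := fun i s => (P s).rep i
  let q : Fin 3 → T → K := fun i s => (Q s).rep i
  have hne0 : ∀ r : T → Plane K, (fun i => germAlgHom U (fun s => (r s).rep i)) ≠ 0 := by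
    intro r h
    have h' : ∀ i, ∀ᶠ s in U, (r s).rep i = 0 := fun i =>
      germAlgHom_eq_zero_iff.1 (congrFun h i)
    obtain ⟨s, hs⟩ := (eventually_all.2 h').exists
    exact (r s).rep_nonzero (funext hs)
  have hsimple : ∀ {h : MvPolynomial (Fin 3) K} {r : T → Plane K},
      (∀ s, IsSimplePoint h (r s)) → ∃ i, aeval
        (fun i => germAlgHom U (fun s => (r s).rep i)) (pderiv i h) ≠ 0 := by
    intro h r hr
    by_contra! hall
    simp only [aeval_germ, germAlgHom_eq_zero_iff] at hall
    obtain ⟨s, hs⟩ := (eventually_all.2 hall).exists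
    obtain ⟨i, hi⟩ := (hr s).2
    exact hi (hs i)
  have hzero : ∀ {h : MvPolynomial (Fin 3) K} {r : T → Plane K},
      (∀ s, IsSimplePoint h (r s)) → aeval
        (fun i => germAlgHom U (fun s => (r s).rep i)) h = 0 := by
    intro h r hr
    rw [aeval_germ, germAlgHom_eq_zero_iff]
    exact .of_forall fun s => (hr s).1
  have hcontra : ∀ {h : MvPolynomial (Fin 3) K} {k : ℕ} {r : T → Plane K}, h.IsHomogeneous k →
      Function.Injective r → (∀ s, IsSimplePoint h (r s)) →
      {P | IsInflectionPoint h P}.Finite →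
      ¬ IsFlex h (fun i => germAlgHom U (fun s => (r s).rep i)) := by
    intro h k r hk hr hs hfin hflex
    refine ((hU hflex.eventually).image hr.injOn) (hfin.subset ?_)
    rintro _ ⟨s, hs', rfl⟩
    exact IsFlex.isInflectionPoint h2 hk (hs s) hs'
  have hfg : ∀ i j,
      aeval (fun i => germAlgHom U (p i)) (pderiv i f) *
        aeval (fun i => germAlgHom U (q i)) (pderiv j g) =
      aeval (fun i => germAlgHom U (p i)) (pderiv j f) *
        aeval (fun i => germAlgHom U (q i)) (pderiv i g) := by
    intro i j
    simp only [aeval_germ, ← map_mul]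
    refine germAlgHom_eq_iff.2 (.of_forall fun s => ?_)
    exact proportional_of_line_eq ((hLP s).symm.trans (hLQ s)) i j
  -- `P` is injective while `U` contains no finite set, so the point of coordinates `p` is not
  -- proportional to a point over `K`.
  have hnc : ∀ (c : Germ (U : Filter T) K) (k : Fin 3 → K),
      (fun i => germAlgHom U (p i)) ≠ c • (algebraMap K (Germ (U : Filter T) K) ∘ k) := by
    intro c k hck
    obtain ⟨γ, rfl⟩ := germAlgHom_surjective c
    have h' : ∀ᶠ s in U, ∀ i, (P s).rep i = γ s * k i := by
      refine eventually_all.2 fun i => ?_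
      have := congrFun hck i
      have : germAlgHom U (fun s => (P s).rep i) = germAlgHom U (γ * fun _ => k i) := by
        rw [this, map_mul]; rfl
      exact germAlgHom_eq_iff.1 this
    refine hU h' (Set.Subsingleton.finite fun s hs s' hs' => hPinj ?_)
    refine eq_of_rep_proportional fun i j => ?_
    rw [hs i, hs j, hs' i, hs' j]
    ring
  rcases proportional_or_isFlex hf hg (hne0 P) (hne0 Q) (hzero hP) (hzero hQ) (hsimple hP)
    (hsimple hQ) hfg hnc with h | h | h
  · have h' : ∀ᶠ s in U, ∀ i j, (P s).rep i * (Q s).rep j = (P s).rep j * (Q s).rep i := by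
      refine eventually_all.2 fun i => eventually_all.2 fun j => ?_
      have := h i j
      rwa [← map_mul, ← map_mul, germAlgHom_eq_iff] at this
    have hass : Associated f g := by
      refine associated_of_infinite_inter hf hg hf_irr hg_irr
        (((hU h').image hPinj.injOn).mono ?_)
      rintro _ ⟨s, hs, rfl⟩
      refine ⟨(hP s).1, ?_⟩
      rw [eq_of_rep_proportional hs]
      exact (hQ s).1
    obtain ⟨u, rfl⟩ := hass
    apply hne
    ext R
    have hu : eval R.rep (u : MvPolynomial (Fin 3) K) ≠ 0 :=
      (u.isUnit.map (eval R.rep)).ne_zero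
    simp [zeroLocus, hu]
  · exact hcontra hf hPinj hP hf_infl h
  · exact hcontra hg hQinj hQ hg_infl h

end PlaneCurve

theorem lemma1p1 {K : Type*} [Field K] [IsAlgClosed K] (hK : ringChar K ≠ 2)
    (f g : MvPolynomial (Fin 3) K) (m n : ℕ)
    (hf : f.IsHomogeneous m) (hg : g.IsHomogeneous n)
    (hf_irr : Irreducible f) (hg_irr : Irreducible g)
    (hne : PlaneCurve.zeroLocus f ≠ PlaneCurve.zeroLocus g)
    (hf_infl : {P | PlaneCurve.IsInflectionPoint f P}.Finite)
    (hg_infl : {P | PlaneCurve.IsInflectionPoint g P}.Finite) :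
    {L : Set (PlaneCurve.Plane K) |
      PlaneCurve.IsTangent f L ∧ PlaneCurve.IsTangent g L}.Finite :=
  PlaneCurve.finite_common_tangents (Ring.two_ne_zero hK) hf hg hf_irr hg_irr hne hf_infl hg_infl
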